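/- Let $\mathbf X\subset\mathbb R^d$ be compact, let $\mathbb K:\mathbf X\times\mathbf X\to\mathbb R$ be a Mercer kernel (continuous, symmetric, positive semidefinite), and let $P,\rho$ be probability measures on $\mathbf X$. Assume that - the operator $T_{\mathbb K}g(x)=\int_{\mathbf X}\mathbb K(x,y)g(y)\,dP(y)$ is one-to-one on $L^2(\mathbf X,P)$, with eigenvalues $\lambda_1\ge\lambda_2\ge\cdots$ (an infinite sequence, counted with multiplicity) and corresponding orthonormal eigenfunctions $(\varphi_k)_{k\ge1}$; - $\rho$ is absolutely continuous with respect to $P$ and $d\rho/dP\le M$ $P$-almost everywhere, for a constant $M>0$; - $f^*\in\mathcal H=\{f\in L^2(P): f=\sum_k a_k\varphi_k,\ \|f\|_{\mathcal H}^2=\sum_k a_k^2/\lambda_k<\infty\}$, with $\|f^*\|_{\mathcal H}\le R$. For $n\ge1$ and $\sigma>0$ let $Y_i=f^*(X_i)+\varepsilon_i$, $1\le i\le n$, where the $X_i$ are i.i.d. with law $\rho$ and the $\varepsilon_i$ are i.i.d., centered, with variance $\sigma^2$, and independent of the $X_i$. For $\lambda>0$ let $$\widehat f_n^\lambda(x)=\sum_{i=1}^n\widehat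 c_i\,\mathbb K(X_i,x),\qquad \widehat c=\big([\mathbb K(X_i,X_j)]_{1\le i,j\le n}+n\lambda I_n\big)^{-1}(Y_1,\dots,Y_n)^T,$$ be the full kernel ridge regression (KRR) estimator, and let $$\mathcal R(\widehat f_n^\lambda)=\mathbb E\Big[\frac1n\sum_{i=1}^n\big(\widehat f_n^\lambda(X_i)-f^*(X_i)\big)^2\Big]$$ be its empirical risk. Let $0<\tau_1\le\tau_2$. 1. (Exponential decay.) Let $b,A>0$, let $N_b\ge1$ be an integer, and suppose that $\lambda_k\le A e^{-bk}$ for all $k\ge N_b$. Put $$r_n=\sigma^2\max\Big(\frac{N_b}{n},\ \frac1{b\,n}\log\frac n{\sigma^2}\Big).$$ There is a constant $C$ depending only on $b,A,M,R,\tau_1,\tau_2$ such that, whenever $\tau_1r_n\le\lambda\le\tau_2r_n$, the risk is finite and $\mathcal R(\widehat f_n^\lambda)\le C\,r_n$. 2. (Polynomial decay.) Let $s>a\ge0$ and $A,D>0$, let $N_s\ge1$ be an integer, and suppose that $\sup_{x\in\mathbf X}|\varphi_k(x)|\le D k^{a/2}$ for all $k\ge1$ and $\lambda_k\le A k^{-2s}$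 for all $k\ge N_s$. Let $\sup_{x}\mathbb K(x,x)\le\kappa$, let $\gamma=\min(1,2-a)$, and put $$r_n=\max\Big(\sigma^2\frac{N_s}{n},\ \Big(\frac n{\sigma^2}\Big)^{-\frac{2s+\gamma-1}{2s+\gamma}}\Big).$$ There is a constant $C$ depending only on $s,a,A,D,\kappa,M,R,\tau_1,\tau_2$ such that, whenever $\tau_1r_n\le\lambda\le\tau_2r_n$, the risk is finite and $\mathcal R(\widehat f_n^\lambda)\le C\,r_n$. In both cases the bound holds for all $n\ge1$ and all $\sigma>0$. So for $\lambda$ of the order of $r_n$ the full KRR estimator has empirical risk $O(r_n)$. -/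

import Mathlib

open MeasureTheory ProbabilityTheory Filter Topology Set

noncomputable section

namespace KRR

/-! ### Kernels, integral operators and their spectral data -/

section Kernel

variable {X : Type*}

/-- A Mercer kernel: a continuous, symmetric, positive semidefinite real kernel. -/
structure IsMercerKernel [TopologicalSpace X] (K : X → X → ℝ) : Prop where
  continuous : Continuous fun p : X × X => K p.1 p.2
  posSemidef : (Matrix.of K).PosSemidef

variable [MeasurableSpace X]

/-- The integral operator `(T_K g)(x) = ∫ K(x, y) g(y) dP(y)`. -/
def integralOperator (K : X → X → ℝ) (P : Measure X) (g : X → ℝ) (x : X) : ℝ :=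
  ∫ y, K x y * g y ∂P

/-- The integral operator is one-to-one on `L²(P)`. -/
def IsInjectiveOnL2 (K : X → X → ℝ) (P : Measure X) : Prop :=
  ∀ g : X → ℝ, MemLp g 2 P → integralOperator K P g =ᵐ[P] 0 → g =ᵐ[P] 0

/-- `ev 0 ≥ ev 1 ≥ …` are the eigenvalues of `T_K` on `L²(P)`, counted with multiplicity, and
`φ 0, φ 1, …` are corresponding orthonormal eigenfunctions. The last field says that no
eigenvalue is missing: `T_K` vanishes on the orthogonal complement of the family `φ`.
The index `k` here corresponds to the index `k + 1` when one counts from one. -/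
structure IsEigenSystem (K : X → X → ℝ) (P : Measure X) (ev : ℕ → ℝ) (φ : ℕ → X → ℝ) :
    Prop where
  antitone : Antitone ev
  memLp : ∀ k, MemLp (φ k) 2 P
  orthonormal : ∀ j k, ∫ x, φ j x * φ k x ∂P = if j = k then 1 else 0
  eigen : ∀ k x, integralOperator K P (φ k) x = ev k * φ k x
  exhaustive : ∀ g : X → ℝ, MemLp g 2 P → (∀ k, ∫ x, g x * φ k x ∂P = 0) →
    integralOperator K P g =ᵐ[P] 0

/-- The coefficient `a_k(f) = ⟨f, φ_k⟩` in `L²(P)`. -/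
def coeff (P : Measure X) (φ : ℕ → X → ℝ) (f : X → ℝ) (k : ℕ) : ℝ :=
  ∫ x, f x * φ k x ∂P

/-- Membership in the reproducing kernel Hilbert space
`{ f ∈ L²(P) : f = ∑ a_k(f) φ_k in L²(P), ∑ a_k(f)² / λ_k < ∞ }`. -/
structure MemRKHS (P : Measure X) (ev : ℕ → ℝ) (φ : ℕ → X → ℝ) (f : X → ℝ) : Prop where
  memLp : MemLp f 2 P
  expansion : Tendsto
    (fun N : ℕ => eLpNorm (fun x => f x - ∑ k ∈ Finset.range N, coeff P φ f k * φ k x) 2 P)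
    atTop (𝓝 0)
  summable : Summable fun k => coeff P φ f k ^ 2 / ev k

/-- The norm `‖f‖_H = (∑ a_k(f)² / λ_k)^(1/2)` of that space. -/
def rkhsNorm (P : Measure X) (ev : ℕ → ℝ) (φ : ℕ → X → ℝ) (f : X → ℝ) : ℝ :=
  √(∑' k, coeff P φ f k ^ 2 / ev k)

/-- `ρ` is absolutely continuous with respect to `P`, with density `dρ/dP` bounded by `M`. -/
structure HasDensityBoundedBy (ρ P : Measure X) (M : ℝ) : Prop where
  absolutelyContinuous : ρ ≪ P
  bounded : ∀ᵐ x ∂P, ρ.rnDeriv P x ≤ ENNReal.ofReal M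

end Kernel

/-! ### The regression model, the estimator and its empirical risk -/

section Model

variable {X : Type*} {n : ℕ}

/-- The covariates `Z i` are i.i.d. with law `ρ`; the noise variables `ε i` are i.i.d., centered,
square integrable with variance `σ²`, and independent of the covariates. -/
structure IsSample [MeasurableSpace X] {Ω : Type*} [MeasurableSpace Ω] (μ : Measure Ω)
    (ρ : Measure X) (σ : ℝ) (Z : Fin n → Ω → X) (ε : Fin n → Ω → ℝ) : Prop where
  measurable_covariate : ∀ i, Measurable (Z i)
  law_covariate : ∀ i, μ.map (Z i) = ρ
  indep_covariate : iIndepFun Z μ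
  memLp_noise : ∀ i, MemLp (ε i) 2 μ
  centered_noise : ∀ i, ∫ ω, ε i ω ∂μ = 0
  variance_noise : ∀ i, ∫ ω, ε i ω ^ 2 ∂μ = σ ^ 2
  identDistrib_noise : ∀ i j, IdentDistrib (ε i) (ε j) μ μ
  indep_noise : iIndepFun ε μ
  indep_covariate_noise : IndepFun (fun ω i => Z i ω) (fun ω i => ε i ω) μ

/-- The full kernel matrix `[K(x_i, x_j)]`. -/
def kernelMatrix (K : X → X → ℝ) (x : Fin n → X) : Matrix (Fin n) (Fin n) ℝ :=
  Matrix.of fun i j => K (x i) (x j)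

/-- The coefficient vector `([K(x_i, x_j)] + n λ I)⁻¹ y`. -/
def krrCoeff (K : X → X → ℝ) (lam : ℝ) (x : Fin n → X) (y : Fin n → ℝ) : Fin n → ℝ :=
  Matrix.mulVec (kernelMatrix K x + ((n : ℝ) * lam) • (1 : Matrix (Fin n) (Fin n) ℝ))⁻¹ y

/-- The full kernel ridge regression estimator `t ↦ ∑ c_i K(x_i, t)` built from data `(x, y)`. -/
def krrEstimator (K : X → X → ℝ) (lam : ℝ) (x : Fin n → X) (y : Fin n → ℝ) (t : X) : ℝ :=
  ∑ i, krrCoeff K lam x y i * K (x i) t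

/-- The empirical squared error `n⁻¹ ∑ (f̂(X_i) - f*(X_i))²` of the full kernel ridge regression
estimator computed from the responses `Y_i = f*(X_i) + ε_i`, as a random variable. -/
def empiricalError {Ω : Type*} (K : X → X → ℝ) (lam : ℝ) (fstar : X → ℝ)
    (Z : Fin n → Ω → X) (ε : Fin n → Ω → ℝ) (ω : Ω) : ℝ :=
  (1 / (n : ℝ)) * ∑ i,
    (krrEstimator K lam (fun j => Z j ω) (fun j => fstar (Z j ω) + ε j ω) (Z i ω)
      - fstar (Z i ω)) ^ 2

end Model

/-! ### The convergence rates -/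

/-- `σ² max(N_b / n, log(n / σ²) / (b n))`. -/
def expRate (b : ℝ) (Nb n : ℕ) (σ : ℝ) : ℝ :=
  σ ^ 2 * max ((Nb : ℝ) / n) (1 / (b * n) * Real.log (n / σ ^ 2))

/-- `max(σ² N_s / n, (n / σ²) ^ (-(2s + γ - 1) / (2s + γ)))` with `γ = min(1, 2 - a)`. -/
def polyRate (s a : ℝ) (Ns n : ℕ) (σ : ℝ) : ℝ :=
  max (σ ^ 2 * ((Ns : ℝ) / n))
    (((n : ℝ) / σ ^ 2) ^ (-((2 * s + min 1 (2 - a) - 1) / (2 * s + min 1 (2 - a)))))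

end KRR

end

/-! Given the covariates, the fitted values are `H Y` with `H = S (S + t I)⁻¹`, `S` the kernel
matrix and `t = n λ`. The noise is centered and independent of the covariates, so the risk is
squared bias plus variance, namely `n⁻¹ E‖(H - I) f*‖² + σ² n⁻¹ E‖H‖²` with the Frobenius norm
(`IsSample.integral_sq_affine`).

Bias: `f*` on the sample lies almost surely in the ellipsoid of `S` of radius `R`
(`MemRKHS.exists_ellipsoid`), which gives at most `λ R²` (`sum_sq_ridge_sub_le`).

Variance: `‖H‖² ≤ tr H`. Split `S` into the first `N` Mercer terms and a remainder `B`. Each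
rank-one term contributes at most 1 to `tr H`, and `B` at most `tr B / t` (`sum_sq_ridge_le`).
Bessel's inequality in a feature space, where the `√λ_k φ_k` are coordinates along an orthonormal
family, shows that `B` is positive semidefinite. Passing from `ρ` to `P` costs a factor `M`, and the
trace formula `∑ λ_k = ∫ K(x, x) dP` (`IsEigenSystem.hasSum_ev`) turns `E tr B` into at most `n M`
times the eigenvalue tail. Hence `risk_le`: risk `≤ λ R² + σ²/n (N + M tail_N / λ)`.

With `x = n / σ²`, both rates have the form `y / x` with `y ≥ 1`. Taking `N = ⌈y⌉`, everything
balances as soon as `tail_N ≤ B y² / x` for a constant `B` (`bias_add_variance_le`). The decay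
assumptions supply this inequality. -/

noncomputable section
namespace KRR

/-! ### Deterministic bias and variance bounds for a ridge smoother. -/

section Ridge

open Matrix

variable {m : Type*} [DecidableEq m]

/-- The regularized matrix `S + t I` of a positive semidefinite `S` is positive definite. -/
lemma posDef_add_smul_one {S : Matrix m m ℝ} (hS : S.PosSemidef) {t : ℝ} (ht : 0 < t) :
    (S + t • (1 : Matrix m m ℝ)).PosDef :=
  Matrix.PosDef.posSemidef_add hS (Matrix.PosDef.one.smul ht)

variable [Fintype m]

lemma isUnit_det_add_smul_one {S : Matrix m m ℝ} (hS : S.PosSemidef) {t : ℝ} (ht : 0 < t) :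
    IsUnit (S + t • (1 : Matrix m m ℝ)).det :=
  (Matrix.isUnit_iff_isUnit_det _).1 (posDef_add_smul_one hS ht).isUnit

open scoped MatrixOrder in
lemma trace_mul_nonneg {S T : Matrix m m ℝ} (hS : S.PosSemidef) (hT : T.PosSemidef) :
    0 ≤ (S * T).trace := by
  obtain ⟨C, rfl⟩ := CStarAlgebra.nonneg_iff_eq_star_mul_self.mp hT.nonneg
  rw [Matrix.star_eq_conjTranspose, ← Matrix.mul_assoc, Matrix.trace_mul_comm, ← Matrix.mul_assoc]
  exact (hS.mul_mul_conjTranspose_same C).trace_nonneg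

/-- The resolvent `(S + t I)⁻¹` commutes with `S`. -/
lemma mul_inv_add_smul_one_comm {S : Matrix m m ℝ} (hS : S.PosSemidef) {t : ℝ} (ht : 0 < t) :
    S * (S + t • (1 : Matrix m m ℝ))⁻¹ = (S + t • (1 : Matrix m m ℝ))⁻¹ * S := by
  have hu := isUnit_det_add_smul_one hS ht
  have h1 : S = (S + t • (1 : Matrix m m ℝ)) - t • 1 := by simp
  set G := S + t • (1 : Matrix m m ℝ)
  rw [h1, sub_mul, mul_sub, Matrix.mul_nonsing_inv _ hu, Matrix.nonsing_inv_mul _ hu]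
  simp

lemma mul_inv_add_smul_one {S : Matrix m m ℝ} (hS : S.PosSemidef) {t : ℝ} (ht : 0 < t) :
    S * (S + t • (1 : Matrix m m ℝ))⁻¹ = 1 - t • (S + t • (1 : Matrix m m ℝ))⁻¹ := by
  have hu := isUnit_det_add_smul_one hS ht
  have h1 : S = (S + t • (1 : Matrix m m ℝ)) - t • 1 := by simp
  set G := S + t • (1 : Matrix m m ℝ)
  rw [h1, sub_mul, Matrix.mul_nonsing_inv _ hu]
  simp

/-- The inverse of a matrix dominating `v vᵀ` satisfies `vᵀ G⁻¹ v ≤ 1`. -/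
lemma dotProduct_inv_mulVec_le_one {G : Matrix m m ℝ} (hG : IsUnit G.det)
    {v : m → ℝ} (hv : ∀ u : m → ℝ, (u ⬝ᵥ v) ^ 2 ≤ u ⬝ᵥ (G *ᵥ u)) :
    v ⬝ᵥ (G⁻¹ *ᵥ v) ≤ 1 := by
  -- Testing at `u = G⁻¹ v` turns the domination into `q² ≤ q` for `q = vᵀ G⁻¹ v`.
  have h := hv (G⁻¹ *ᵥ v)
  rw [Matrix.mulVec_mulVec, Matrix.mul_nonsing_inv _ hG, Matrix.one_mulVec,
    dotProduct_comm _ v] at h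
  nlinarith [sq_nonneg (v ⬝ᵥ (G⁻¹ *ᵥ v) - 1)]

/-- Effective dimension bound: the squared Frobenius norm of the ridge smoother
`S (S + t I)⁻¹` is at most the number of removed rank-one components plus the trace of the
remainder divided by `t`. -/
theorem sum_sq_ridge_le {S : Matrix m m ℝ} (hS : S.PosSemidef) {t : ℝ} (ht : 0 < t) (N : ℕ)
    (v : ℕ → m → ℝ)
    (hB : (S - ∑ k ∈ Finset.range N, vecMulVec (v k) (v k)).PosSemidef) :
    ∑ i, ∑ j, (S * (S + t • (1 : Matrix m m ℝ))⁻¹) i j ^ 2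
      ≤ N + (∑ i, (S i i - ∑ k ∈ Finset.range N, v k i ^ 2)) / t := by
  have hG := posDef_add_smul_one hS ht
  have hu := isUnit_det_add_smul_one hS ht
  have hcomm := mul_inv_add_smul_one_comm hS ht
  have hone := mul_inv_add_smul_one hS ht
  set G := S + t • (1 : Matrix m m ℝ) with hGdef
  set B := S - ∑ k ∈ Finset.range N, vecMulVec (v k) (v k) with hBdef
  have hGi : (G⁻¹).PosSemidef := hG.inv.posSemidef
  have hGis : (G⁻¹)ᵀ = G⁻¹ := by simpa using hGi.1.eq
  have hSs : Sᵀ = S := by simpa using hS.1.eq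
  have hHs : (S * G⁻¹)ᵀ = S * G⁻¹ := by rw [Matrix.transpose_mul, hGis, hSs, hcomm]
  have hfrob : ∑ i, ∑ j, (S * G⁻¹) i j ^ 2 = ((S * G⁻¹) * (S * G⁻¹)).trace := by
    nth_rewrite 3 [← hHs]
    simp only [Matrix.trace, Matrix.diag, Matrix.mul_apply (M := S * G⁻¹), Matrix.transpose_apply,
      sq]
  have hquad : ∀ T : Matrix m m ℝ, T.PosSemidef → (G⁻¹ * T * G⁻¹).PosSemidef := by
    intro T hT
    have := hT.mul_mul_conjTranspose_same (G⁻¹)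
    rwa [hGi.1.eq] at this
  -- The eigenvalues of `H` lie in `[0, 1]`; concretely, `H - H² = t G⁻¹ S G⁻¹` is positive
  -- semidefinite.
  have h1 : ((S * G⁻¹) * (S * G⁻¹)).trace ≤ (S * G⁻¹).trace := by
    have h2 : S * G⁻¹ - (S * G⁻¹) * (S * G⁻¹) = t • (G⁻¹ * S * G⁻¹) := by
      nth_rewrite 2 [hone]
      rw [sub_mul, one_mul, smul_mul_assoc, Matrix.mul_assoc]
      simp
    have h3 := (hquad S hS).trace_nonneg
    have h4 := congrArg Matrix.trace h2
    rw [Matrix.trace_sub, Matrix.trace_smul, smul_eq_mul] at h4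
    nlinarith [mul_nonneg ht.le h3]
  have h5 : (G⁻¹ * B).trace ≤ B.trace / t := by
    have h6 : (t⁻¹ • (1 : Matrix m m ℝ) - G⁻¹).PosSemidef := by
      -- Matrix form of `1/t - 1/(s+t) = s(s+t) / (t (s+t)²)`, written as a congruence so that
      -- positivity is visible.
      have h7 : t⁻¹ • (1 : Matrix m m ℝ) - G⁻¹ = t⁻¹ • (G⁻¹ * (S * S + t • S) * G⁻¹) := by
        have h8 : S * S + t • S = S * G := by rw [hGdef, mul_add]; simp
        rw [h8, Matrix.mul_assoc, Matrix.mul_assoc, Matrix.mul_nonsing_inv _ hu, Matrix.mul_one,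
          ← hcomm, hone, smul_sub, smul_smul, inv_mul_cancel₀ ht.ne', one_smul]
      rw [h7]
      have hSS : (S * S).PosSemidef := by
        have := Matrix.posSemidef_self_mul_conjTranspose S
        rwa [hS.1.eq] at this
      exact (hquad _ (hSS.add (hS.smul ht.le))).smul (by positivity)
    have h9 := trace_mul_nonneg h6 hB
    rw [sub_mul, Matrix.trace_sub, smul_mul_assoc, one_mul, Matrix.trace_smul, smul_eq_mul] at h9
    rw [div_eq_inv_mul]
    linarith
  have h10 : (S * G⁻¹).trace
      = ∑ k ∈ Finset.range N, v k ⬝ᵥ (G⁻¹ *ᵥ v k) + (G⁻¹ * B).trace := by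
    have : S = ∑ k ∈ Finset.range N, vecMulVec (v k) (v k) + B := by rw [hBdef]; abel
    rw [hcomm]
    rw [congrArg (fun T => G⁻¹ * T) this, mul_add, Matrix.trace_add,
      Finset.mul_sum, Matrix.trace_sum]
    congr 1
    refine Finset.sum_congr rfl fun k _ => ?_
    rw [Matrix.mul_vecMulVec, Matrix.trace_vecMulVec, dotProduct_comm]
  -- `G` dominates each `v_k v_kᵀ`, because `B`, `t I` and the other rank-one terms are positive
  -- semidefinite.
  have h11 : ∀ k ∈ Finset.range N, v k ⬝ᵥ (G⁻¹ *ᵥ v k) ≤ 1 := by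
    intro k hk
    refine dotProduct_inv_mulVec_le_one hu fun u => ?_
    have hBu := hB.dotProduct_mulVec_nonneg u
    rw [star_trivial, Matrix.sub_mulVec, dotProduct_sub, Matrix.sum_mulVec, dotProduct_sum] at hBu
    have h12 : ∀ l, u ⬝ᵥ (vecMulVec (v l) (v l) *ᵥ u) = (u ⬝ᵥ v l) ^ 2 := by
      intro l
      rw [Matrix.vecMulVec_mulVec, dotProduct_comm (v l) u]
      simp [sq]
    simp only [h12] at hBu
    have h13 : (u ⬝ᵥ v k) ^ 2 ≤ ∑ l ∈ Finset.range N, (u ⬝ᵥ v l) ^ 2 :=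
      Finset.single_le_sum (f := fun l => (u ⬝ᵥ v l) ^ 2) (fun _ _ => sq_nonneg _) hk
    have h14 : u ⬝ᵥ (G *ᵥ u) = u ⬝ᵥ (S *ᵥ u) + t * (u ⬝ᵥ u) := by
      rw [hGdef, Matrix.add_mulVec, dotProduct_add, Matrix.smul_mulVec, Matrix.one_mulVec,
        dotProduct_smul, smul_eq_mul]
    have h15 : 0 ≤ u ⬝ᵥ u := by simpa using dotProduct_star_self_nonneg u
    nlinarith [mul_nonneg ht.le h15]
  have h16 : B.trace = ∑ i, (S i i - ∑ k ∈ Finset.range N, v k i ^ 2) := by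
    rw [hBdef]
    simp [Matrix.trace, Matrix.sum_apply, vecMulVec_apply, sq]
  rw [hfrob, ← h16]
  have h17 := Finset.sum_le_sum h11
  simp only [Finset.sum_const, Finset.card_range, nsmul_eq_mul, mul_one] at h17
  linarith

/-- Bias bound: if `f` lies in the ellipsoid `(c · f)² ≤ R² cᵀ S c`, then the ridge smoother
moves `f` by at most `√t R`. -/
theorem sum_sq_ridge_sub_le {S : Matrix m m ℝ} (hS : S.PosSemidef) {t : ℝ} (ht : 0 < t)
    {f : m → ℝ} {R : ℝ} (hf : ∀ c : m → ℝ, (c ⬝ᵥ f) ^ 2 ≤ R ^ 2 * (c ⬝ᵥ (S *ᵥ c))) :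
    ∑ i, (((S * (S + t • (1 : Matrix m m ℝ))⁻¹) *ᵥ f) i - f i) ^ 2 ≤ t * R ^ 2 := by
  have hu := isUnit_det_add_smul_one hS ht
  rw [mul_inv_add_smul_one hS ht]
  set G := S + t • (1 : Matrix m m ℝ) with hGdef
  set u := G⁻¹ *ᵥ f with hudef
  have hfu : f = S *ᵥ u + t • u := by
    have : G *ᵥ u = f := by
      rw [hudef, Matrix.mulVec_mulVec, Matrix.mul_nonsing_inv _ hu, Matrix.one_mulVec]
    rw [← this, hGdef, Matrix.add_mulVec, Matrix.smul_mulVec, Matrix.one_mulVec]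
  have h1 : u ⬝ᵥ f = u ⬝ᵥ (S *ᵥ u) + t * (u ⬝ᵥ u) := by
    nth_rewrite 1 [hfu]
    rw [dotProduct_add, dotProduct_smul, smul_eq_mul]
  have h2 := hf u
  have h3 : 0 ≤ u ⬝ᵥ u := by simpa using dotProduct_star_self_nonneg u
  have h4 : 0 ≤ u ⬝ᵥ (S *ᵥ u) := by simpa using hS.dotProduct_mulVec_nonneg u
  rw [h1] at h2
  -- With `α = uᵀ S u` and `β = t ‖u‖²`, the hypothesis reads `(α + β)² ≤ R² α`. If `β > R²`, the
  -- left side is at least `α β + β² > R² α`.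
  have h5 : t * (u ⬝ᵥ u) ≤ R ^ 2 := by
    by_contra hcon
    push Not at hcon
    have h6 : 0 < t * (u ⬝ᵥ u) := lt_of_le_of_lt (sq_nonneg R) hcon
    nlinarith [mul_nonneg h4 (sub_nonneg.2 hcon.le), mul_nonneg h4 h6.le, mul_pos h6 h6]
  have h6 : ∀ i, ((1 - t • G⁻¹) *ᵥ f) i - f i = -(t * u i) := by
    intro i
    rw [Matrix.sub_mulVec, Matrix.one_mulVec, Matrix.smul_mulVec, ← hudef]
    simp
  simp only [h6]
  have h7 : ∑ i, (-(t * u i)) ^ 2 = t * (t * (u ⬝ᵥ u)) := by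
    simp only [dotProduct, Finset.mul_sum]
    exact Finset.sum_congr rfl fun i _ => by ring
  rw [h7]
  exact mul_le_mul_of_nonneg_left h5 ht.le

end Ridge

/-! ### Feature maps of positive semidefinite kernels. -/

section FeatureMap

universe u

open scoped InnerProductSpace

/-- A real positive semidefinite kernel has a feature map into a Hilbert space. -/
theorem exists_featureMap {X : Type u} {K : X → X → ℝ} (hK : (Matrix.of K).PosSemidef) :
    ∃ (H : Type u) (_ : NormedAddCommGroup H) (_ : InnerProductSpace ℝ H) (_ : CompleteSpace H)
      (Ψ : X → H), ∀ x y, ⟪Ψ x, Ψ y⟫_ℝ = K x y := by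
  -- The scalar kernel is viewed as operator-valued, acting on `ℝ` by multiplication, to use the
  -- general RKHS construction.
  let K' : Matrix X X (ℝ →L[ℝ] ℝ) := Matrix.of fun x y => K x y • (1 : ℝ →L[ℝ] ℝ)
  have hsymm : ∀ x y, K x y = K y x := fun x y => by
    simpa using (hK.1.apply x y).symm
  have hK' : K'.PosSemidef := by
    have htfae := (RKHS.posSemidef_tfae (K := K')).out 0 2
    refine htfae.2 ⟨?_, fun w => ?_⟩
    · ext x y
      simp [K', hsymm x y, Matrix.conjTranspose_apply]
    · refine (hK.2 w).trans_eq ?_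
      simp only [Finsupp.sum, map_sum]
      refine Finset.sum_congr rfl fun i _ => Finset.sum_congr rfl fun j _ => ?_
      simp [K', hsymm i j]
      ring
  have : Fact K'.PosSemidef := ⟨hK'⟩
  refine ⟨RKHS.OfKernel K', inferInstance, inferInstance, inferInstance,
    fun x => RKHS.kerFun (RKHS.OfKernel K') x 1, fun x y => ?_⟩
  have h := RKHS.kernel_inner (RKHS.OfKernel K') y x (1 : ℝ) (1 : ℝ)
  rw [← h, RKHS.OfKernel.kernel_ofKernel]
  simp [K', hsymm x y]

variable {X : Type*} [TopologicalSpace X] {K : X → X → ℝ} {H : Type*} [NormedAddCommGroup H]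
  [InnerProductSpace ℝ H] {Ψ : X → H}

lemma continuous_featureMap (hK : Continuous fun p : X × X => K p.1 p.2)
    (hΨ : ∀ x y, ⟪Ψ x, Ψ y⟫_ℝ = K x y) : Continuous Ψ := by
  rw [continuous_iff_continuousAt]
  intro x
  rw [ContinuousAt, tendsto_iff_norm_sub_tendsto_zero]
  have h1 : ∀ y, ‖Ψ y - Ψ x‖ = √(K y y - 2 * K y x + K x x) := by
    intro y
    rw [← hΨ, ← hΨ, ← hΨ, real_inner_self_eq_norm_sq, real_inner_self_eq_norm_sq,
      ← norm_sub_sq_real, Real.sqrt_sq (norm_nonneg _)]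
  simp only [h1]
  have hd : Continuous fun y => K y y := hK.comp (continuous_id.prodMk continuous_id)
  have hx : Continuous fun y => K y x := hK.comp (continuous_id.prodMk continuous_const)
  have h2 : Continuous fun y => √(K y y - 2 * K y x + K x x) := by fun_prop
  have h3 := h2.tendsto x
  simpa [two_mul] using h3

end FeatureMap

/-! ### Embedding of `L²(P)` functions into the feature space. -/

section MeanEmbedding

open scoped InnerProductSpace

variable {X : Type*} [TopologicalSpace X] [CompactSpace X] [SecondCountableTopology X]
  [MeasurableSpace X] [BorelSpace X] {P : Measure X} [IsProbabilityMeasure P]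
  {K : X → X → ℝ} {H : Type*} [NormedAddCommGroup H] [InnerProductSpace ℝ H] {Ψ : X → H}

omit [SecondCountableTopology X] [MeasurableSpace X] [BorelSpace X] [InnerProductSpace ℝ H] in
lemma exists_norm_le_of_continuous (hc : Continuous Ψ) : ∃ C, ∀ x, ‖Ψ x‖ ≤ C := by
  obtain ⟨C, hC⟩ := isCompact_univ.exists_bound_of_continuousOn hc.continuousOn
  exact ⟨C, fun x => hC x (mem_univ x)⟩

omit [IsProbabilityMeasure P] in
lemma integrable_smul_featureMap (hc : Continuous Ψ) {g : X → ℝ} (hg : Integrable g P) :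
    Integrable (fun y => g y • Ψ y) P := by
  obtain ⟨C, hC⟩ := exists_norm_le_of_continuous hc
  refine (hg.norm.mul_const C).mono' (hg.1.smul hc.aestronglyMeasurable) ?_
  refine Eventually.of_forall fun y => ?_
  rw [norm_smul]
  exact mul_le_mul_of_nonneg_left (hC y) (norm_nonneg _)

omit [SecondCountableTopology X] in
lemma memLp_inner_featureMap (hc : Continuous Ψ) (w : H) :
    MemLp (fun y => ⟪w, Ψ y⟫_ℝ) 2 P := by
  have hcw : Continuous fun y => ⟪w, Ψ y⟫_ℝ := continuous_const.inner hc
  obtain ⟨C, hC⟩ := exists_norm_le_of_continuous hcw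
  exact MemLp.of_bound hcw.aestronglyMeasurable C (Eventually.of_forall hC)

variable [CompleteSpace H]

omit [IsProbabilityMeasure P] in
lemma inner_meanEmbedding (hc : Continuous Ψ) {g : X → ℝ} (hg : Integrable g P) (w : H) :
    ⟪w, ∫ y, g y • Ψ y ∂P⟫_ℝ = ∫ y, ⟪w, Ψ y⟫_ℝ * g y ∂P := by
  rw [← integral_inner (integrable_smul_featureMap hc hg)]
  refine integral_congr_ae (Eventually.of_forall fun y => ?_)
  simp only [inner_smul_right]
  ring

variable {ev : ℕ → ℝ} {φ : ℕ → X → ℝ}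

/-- Paired with `Ψ y`, the embedding of `φ_j` gives `T_K φ_j (y) = λ_j φ_j(y)`, so the Gram matrix
reduces to orthonormality in `L²(P)`. -/
lemma inner_meanEmbedding_eigen (hc : Continuous Ψ) (hΨ : ∀ x y, ⟪Ψ x, Ψ y⟫_ℝ = K x y)
    (hS : IsEigenSystem K P ev φ) (j k : ℕ) :
    ⟪∫ y, φ j y • Ψ y ∂P, ∫ y, φ k y • Ψ y ∂P⟫_ℝ = if j = k then ev j else 0 := by
  have hint : ∀ k, Integrable (φ k) P := fun k => (hS.memLp k).integrable (by norm_num)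
  rw [inner_meanEmbedding hc (hint k)]
  have h1 : ∀ y, ⟪∫ y, φ j y • Ψ y ∂P, Ψ y⟫_ℝ = ev j * φ j y := by
    intro y
    rw [real_inner_comm, inner_meanEmbedding hc (hint j), ← hS.eigen j y]
    simp only [hΨ, integralOperator]
  simp only [h1, mul_assoc]
  rw [integral_const_mul, hS.orthonormal]
  simp

/-- The eigenvalues of an injective Mercer operator are positive. -/
lemma IsEigenSystem.ev_pos (hK : IsMercerKernel K) (hS : IsEigenSystem K P ev φ)
    (hinj : IsInjectiveOnL2 K P) (k : ℕ) : 0 < ev k := by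
  obtain ⟨H, _, _, _, Ψ, hΨ⟩ := exists_featureMap hK.posSemidef
  have hc := continuous_featureMap hK.continuous hΨ
  have h1 := inner_meanEmbedding_eigen hc hΨ hS k k
  rw [if_pos rfl] at h1
  -- `λ_k` is a squared norm. If it vanished, injectivity would make `φ_k` null, against its unit
  -- norm.
  refine lt_of_le_of_ne (h1 ▸ real_inner_self_nonneg) fun h0 => ?_
  have h2 : φ k =ᵐ[P] 0 := hinj _ (hS.memLp k) <| Eventually.of_forall fun x => by
    rw [hS.eigen k x, ← h0]; simp
  have h3 := hS.orthonormal k k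
  rw [if_pos rfl, integral_congr_ae (g := fun _ => (0 : ℝ))] at h3
  · simp at h3
  · filter_upwards [h2] with x hx
    simp [hx]

end MeanEmbedding

/-! ### Mercer expansion, trace formula and the RKHS ellipsoid. -/

section Mercer

universe u

open scoped InnerProductSpace

variable {X : Type u} [TopologicalSpace X] [CompactSpace X] [SecondCountableTopology X]
  [MeasurableSpace X] [BorelSpace X] {P : Measure X} [IsProbabilityMeasure P]
  {K : X → X → ℝ} {ev : ℕ → ℝ} {φ : ℕ → X → ℝ}

/-- An injective Mercer operator has a feature map in whose feature space the functions
`√λ_k φ_k` are the coordinates of an orthonormal family, which is complete on the support of the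
measure. -/
theorem IsEigenSystem.exists_orthonormal (hK : IsMercerKernel K)
    (hS : IsEigenSystem K P ev φ) (hinj : IsInjectiveOnL2 K P) :
    ∃ (H : Type u) (_ : NormedAddCommGroup H) (_ : InnerProductSpace ℝ H) (_ : CompleteSpace H)
      (Ψ : X → H) (b : ℕ → H), (∀ x y, ⟪Ψ x, Ψ y⟫_ℝ = K x y) ∧ Orthonormal ℝ b ∧
        (∀ k x, ⟪b k, Ψ x⟫_ℝ = √(ev k) * φ k x) ∧
        ∀ w : H, (∀ k, ⟪b k, w⟫_ℝ = 0) → ∀ x ∈ P.support, ⟪w, Ψ x⟫_ℝ = 0 := by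
  obtain ⟨H, i1, i2, i3, Ψ, hΨ⟩ := exists_featureMap hK.posSemidef
  have hc := continuous_featureMap hK.continuous hΨ
  have hint : ∀ k, Integrable (φ k) P := fun k => (hS.memLp k).integrable (by norm_num)
  have hpos : ∀ k, 0 < ev k := hS.ev_pos hK hinj
  have hsq : ∀ k, √(ev k) ≠ 0 := fun k => (Real.sqrt_pos.2 (hpos k)).ne'
  -- The embedding of `φ_k` has squared norm `λ_k`, hence the normalization by `√λ_k`.
  refine ⟨H, i1, i2, i3, Ψ, fun k => (√(ev k))⁻¹ • ∫ y, φ k y • Ψ y ∂P, hΨ, ?_, ?_, ?_⟩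
  · rw [orthonormal_iff_ite]
    intro j k
    rw [real_inner_smul_left, real_inner_smul_right, inner_meanEmbedding_eigen hc hΨ hS]
    split_ifs with h
    · subst h
      have := Real.mul_self_sqrt (hpos j).le
      have := hsq j
      field_simp
      linarith
    · simp
  · intro k x
    rw [real_inner_smul_left, real_inner_comm, inner_meanEmbedding hc (hint k)]
    simp only [hΨ]
    have h1 := hS.eigen k x
    rw [integralOperator] at h1
    have := Real.mul_self_sqrt (hpos k).le
    have := hsq k
    rw [h1, ← mul_assoc]
    congr 1
    field_simp
    linarith
  · intro w hw x hx
    have hcw : Continuous fun y => ⟪w, Ψ y⟫_ℝ := continuous_const.inner hc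
    have hmem := memLp_inner_featureMap (P := P) hc w
    have h0 : ∀ k, ∫ y, ⟪w, Ψ y⟫_ℝ * φ k y ∂P = 0 := by
      intro k
      have h1 := hw k
      rw [real_inner_smul_left, real_inner_comm, inner_meanEmbedding hc (hint k)] at h1
      exact (mul_eq_zero.1 h1).resolve_left (inv_ne_zero (hsq k))
    -- `⟪w, Ψ ·⟫` is orthogonal to every `φ_k`, so `T_K` kills it and it vanishes almost everywhere;
    -- continuity extends this to the whole support.
    have h2 := hinj _ hmem (hS.exhaustive _ hmem h0)
    by_contra hne
    have hU : {y | ⟪w, Ψ y⟫_ℝ ≠ 0} ∈ 𝓝 x :=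
      (isOpen_ne_fun hcw continuous_const).mem_nhds hne
    exact ((Measure.mem_support_iff_forall x).1 hx _ hU).ne' (ae_iff.1 h2)

open Matrix in
/-- Removing finitely many terms of the Mercer expansion leaves a positive semidefinite kernel
matrix. -/
theorem IsEigenSystem.posSemidef_sub (hK : IsMercerKernel K)
    (hS : IsEigenSystem K P ev φ) (hinj : IsInjectiveOnL2 K P) {n : ℕ} (x : Fin n → X) (N : ℕ) :
    (kernelMatrix K x - ∑ k ∈ Finset.range N,
      vecMulVec (fun i => √(ev k) * φ k (x i)) (fun i => √(ev k) * φ k (x i))).PosSemidef := by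
  obtain ⟨H, _, _, _, Ψ, b, hΨ, hb, hbΨ, -⟩ := hS.exists_orthonormal hK hinj
  refine .of_dotProduct_mulVec_nonneg ?_ fun c => ?_
  · ext i j
    simp [kernelMatrix, Matrix.sum_apply, vecMulVec_apply, mul_comm, ← hΨ, real_inner_comm]
  · have h1 := hb.sum_inner_products_le (∑ i, c i • Ψ (x i)) (s := Finset.range N)
    rw [star_trivial, Matrix.sub_mulVec, dotProduct_sub, Matrix.sum_mulVec, dotProduct_sum,
      sub_nonneg]
    refine (Eq.trans_le ?_ h1).trans_eq ?_
    · refine Finset.sum_congr rfl fun k _ => ?_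
      rw [inner_sum, Matrix.vecMulVec_mulVec]
      simp only [real_inner_smul_right, hbΨ, Real.norm_eq_abs, sq_abs, dotProduct]
      simp only [op_smul_eq_smul, Pi.smul_apply, smul_eq_mul, sq, Finset.sum_mul]
      refine Finset.sum_congr rfl fun i _ => ?_
      simp only [Finset.mul_sum]
      exact Finset.sum_congr rfl fun j _ => by ring
    · rw [← real_inner_self_eq_norm_sq, sum_inner]
      simp only [inner_sum, real_inner_smul_left, real_inner_smul_right, hΨ]
      simp [dotProduct, mulVec, kernelMatrix, Finset.mul_sum, mul_comm, mul_left_comm]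

/-- Mercer's expansion on the diagonal, at points of the support. -/
theorem IsEigenSystem.hasSum_diag (hK : IsMercerKernel K)
    (hS : IsEigenSystem K P ev φ) (hinj : IsInjectiveOnL2 K P) {x : X} (hx : x ∈ P.support) :
    HasSum (fun k => ev k * φ k x ^ 2) (K x x) := by
  obtain ⟨H, _, _, _, Ψ, b, hΨ, hb, hbΨ, hcomp⟩ := hS.exists_orthonormal hK hinj
  have hpos : ∀ k, 0 < ev k := hS.ev_pos hK hinj
  have hsum : Summable fun k => ⟪b k, Ψ x⟫_ℝ • b k := by
    have h := hb.orthogonalFamily.summable_iff_norm_sq_summable (fun k => ⟪b k, Ψ x⟫_ℝ)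
    simp only [LinearIsometry.toSpanSingleton_apply] at h
    exact h.2 (hb.inner_products_summable _)
  obtain ⟨p, hp⟩ := hsum
  -- The part of `Ψ x` outside the span of the `b_k` need not vanish, but completeness on the
  -- support makes it orthogonal to `Ψ x`, which suffices.
  have h1 : ∀ j, ⟪b j, Ψ x - p⟫_ℝ = 0 := by
    intro j
    have h2 := hp.mapL (innerSL ℝ (b j))
    have h3 : HasSum (fun k => innerSL ℝ (b j) (⟪b k, Ψ x⟫_ℝ • b k)) ⟪b j, Ψ x⟫_ℝ := by
      convert hasSum_ite_eq j ⟪b j, Ψ x⟫_ℝ using 2 with k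
      rw [innerSL_apply_apply, real_inner_smul_right, orthonormal_iff_ite.1 hb]
      by_cases h : k = j
      · subst h; simp
      · simp [h, Ne.symm h]
    rw [inner_sub_right, sub_eq_zero]
    exact h3.unique h2
  have h4 := hcomp _ h1 x hx
  rw [inner_sub_left, hΨ, sub_eq_zero] at h4
  rw [h4, real_inner_comm]
  have h5 : ∀ k, innerSL ℝ (Ψ x) (⟪b k, Ψ x⟫_ℝ • b k) = ev k * φ k x ^ 2 := by
    intro k
    rw [innerSL_apply_apply, real_inner_smul_right, real_inner_comm (b k) (Ψ x), hbΨ]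
    have := Real.mul_self_sqrt (hpos k).le
    linear_combination (φ k x) ^ 2 * this
  have h6 := hp.mapL (innerSL ℝ (Ψ x))
  rw [funext h5] at h6
  exact h6

omit [CompactSpace X] [SecondCountableTopology X] [MeasurableSpace X] [BorelSpace X] in
lemma IsMercerKernel.continuous_diag (hK : IsMercerKernel K) : Continuous fun x => K x x :=
  hK.continuous.comp (continuous_id.prodMk continuous_id)

omit [SecondCountableTopology X] in
lemma IsMercerKernel.integrable_diag (hK : IsMercerKernel K) : Integrable (fun x => K x x) P := by
  obtain ⟨C, hC⟩ := exists_norm_le_of_continuous hK.continuous_diag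
  exact Integrable.of_bound hK.continuous_diag.aestronglyMeasurable C (Eventually.of_forall hC)

omit [TopologicalSpace X] [CompactSpace X] [SecondCountableTopology X] [BorelSpace X]
  [IsProbabilityMeasure P] in
lemma IsEigenSystem.integral_eigen_sq (hS : IsEigenSystem K P ev φ) (k : ℕ) :
    ∫ x, ev k * φ k x ^ 2 ∂P = ev k := by
  have := hS.orthonormal k k
  simp only [← sq, if_true] at this
  rw [integral_const_mul, this, mul_one]

omit [TopologicalSpace X] [CompactSpace X] [SecondCountableTopology X] [BorelSpace X]
  [IsProbabilityMeasure P] in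
lemma IsEigenSystem.integrable_eigen_sq (hS : IsEigenSystem K P ev φ) (k : ℕ) :
    Integrable (fun x => ev k * φ k x ^ 2) P :=
  (hS.memLp k).integrable_sq.const_mul _

/-- The trace formula `∑ λ_k = ∫ K(x, x) dP(x)`. -/
theorem IsEigenSystem.hasSum_ev (hK : IsMercerKernel K)
    (hS : IsEigenSystem K P ev φ) (hinj : IsInjectiveOnL2 K P) :
    HasSum ev (∫ x, K x x ∂P) := by
  have hpos : ∀ k, 0 < ev k := hS.ev_pos hK hinj
  have hdiag : ∀ᵐ x ∂P, HasSum (fun k => ev k * φ k x ^ 2) (K x x) := by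
    filter_upwards [Measure.support_mem_ae (μ := P)] with x hx
    exact hS.hasSum_diag hK hinj hx
  have hterm : ∀ k x, 0 ≤ ev k * φ k x ^ 2 := fun k x => mul_nonneg (hpos k).le (sq_nonneg _)
  have hsummable : Summable ev := by
    refine summable_of_sum_le (c := ∫ x, K x x ∂P) (fun k => (hpos k).le) fun u => ?_
    calc ∑ k ∈ u, ev k = ∫ x, ∑ k ∈ u, ev k * φ k x ^ 2 ∂P := by
          rw [integral_finsetSum _ fun k _ => hS.integrable_eigen_sq k]
          simp only [hS.integral_eigen_sq]
      _ ≤ ∫ x, K x x ∂P := by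
          refine integral_mono_ae (integrable_finsetSum _ fun k _ => hS.integrable_eigen_sq k)
            hK.integrable_diag ?_
          filter_upwards [hdiag] with x hx
          exact sum_le_hasSum u (fun k _ => hterm k x) hx
  have h1 := hasSum_integral_of_summable_integral_norm (μ := P)
    (F := fun k x => ev k * φ k x ^ 2) hS.integrable_eigen_sq (by
      simp only [Real.norm_of_nonneg (hterm _ _), hS.integral_eigen_sq]
      exact hsummable)
  simp only [hS.integral_eigen_sq] at h1
  rwa [integral_congr_ae (g := fun x => K x x)] at h1
  filter_upwards [hdiag] with x hx using hx.tsum_eq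

open Matrix in
/-- A function of the RKHS, seen on a sample of `P`-almost all points, lies in the ellipsoid of
the kernel matrix. -/
theorem MemRKHS.exists_ellipsoid {f : X → ℝ} {R : ℝ} (hK : IsMercerKernel K)
    (hS : IsEigenSystem K P ev φ) (hinj : IsInjectiveOnL2 K P) (hf : MemRKHS P ev φ f)
    (hR : rkhsNorm P ev φ f ≤ R) :
    ∃ S ∈ ae P, ∀ (n : ℕ) (x : Fin n → X), (∀ i, x i ∈ S) → ∀ c : Fin n → ℝ,
      (c ⬝ᵥ fun i => f (x i)) ^ 2 ≤ R ^ 2 * (c ⬝ᵥ (kernelMatrix K x *ᵥ c)) := by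
  obtain ⟨H, _, _, _, Ψ, b, hΨ, hb, hbΨ, -⟩ := hS.exists_orthonormal hK hinj
  have hpos : ∀ k, 0 < ev k := hS.ev_pos hK hinj
  set g : ℕ → X → ℝ := fun N x => ∑ k ∈ Finset.range N, coeff P φ f k * φ k x with hg
  have hgm : ∀ N, MemLp (g N) 2 P := fun N =>
    memLp_finsetSum _ fun k _ => (hS.memLp k).const_mul _
  have hconv : Tendsto (fun N => eLpNorm (g N - f) 2 P) atTop (𝓝 0) := by
    refine hf.expansion.congr fun N => ?_
    rw [← eLpNorm_neg]
    congr 1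
    ext x
    simp [hg]
  -- The expansion converges only in `L²(P)`; a subsequence converges pointwise off a null set,
  -- which is all the finite sample needs.
  obtain ⟨ns, -, hns⟩ := (tendstoInMeasure_of_tendsto_eLpNorm (by norm_num)
    (fun N => (hgm N).1) hf.memLp.1 hconv).exists_seq_tendsto_ae
  have hnorm : ∑' k, coeff P φ f k ^ 2 / ev k ≤ R ^ 2 := by
    have h0 : 0 ≤ ∑' k, coeff P φ f k ^ 2 / ev k :=
      tsum_nonneg fun k => div_nonneg (sq_nonneg _) (hpos k).le
    rw [← Real.sq_sqrt h0]
    exact pow_le_pow_left₀ (Real.sqrt_nonneg _) hR 2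
  refine ⟨_, hns, fun n x hx c => ?_⟩
  set w := ∑ i, c i • Ψ (x i) with hw
  have hww : c ⬝ᵥ (kernelMatrix K x *ᵥ c) = ‖w‖ ^ 2 := by
    rw [← real_inner_self_eq_norm_sq, hw, sum_inner]
    simp only [inner_sum, real_inner_smul_left, real_inner_smul_right, hΨ]
    simp [dotProduct, mulVec, kernelMatrix, Finset.mul_sum, mul_comm, mul_left_comm]
  have hbw : ∀ k, ⟪b k, w⟫_ℝ = √(ev k) * ∑ i, c i * φ k (x i) := by
    intro k
    rw [hw, inner_sum, Finset.mul_sum]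
    refine Finset.sum_congr rfl fun i _ => ?_
    rw [real_inner_smul_right, hbΨ]
    ring
  -- Cauchy–Schwarz with weights `a_k / √λ_k` against the coordinates of `w`, then Bessel.
  have hpart : ∀ N, (∑ i, c i * g N (x i)) ^ 2 ≤ R ^ 2 * ‖w‖ ^ 2 := by
    intro N
    have h1 : ∑ i, c i * g N (x i)
        = ∑ k ∈ Finset.range N, (coeff P φ f k / √(ev k)) * ⟪b k, w⟫_ℝ := by
      simp only [hg, Finset.mul_sum]
      rw [Finset.sum_comm]
      refine Finset.sum_congr rfl fun k _ => ?_
      have := (Real.sqrt_pos.2 (hpos k)).ne'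
      rw [hbw, ← mul_assoc, div_mul_cancel₀ _ this, Finset.mul_sum]
      exact Finset.sum_congr rfl fun i _ => by ring
    rw [h1]
    refine (Finset.sum_mul_sq_le_sq_mul_sq _ _ _).trans ?_
    refine mul_le_mul ?_ ?_ (Finset.sum_nonneg fun _ _ => sq_nonneg _) (sq_nonneg _)
    · simp only [div_pow, Real.sq_sqrt (hpos _).le]
      exact (hf.summable.sum_le_tsum _
        fun k _ => div_nonneg (sq_nonneg _) (hpos k).le).trans hnorm
    · simpa using hb.sum_inner_products_le w (s := Finset.range N)
  rw [hww]
  have hlim : Tendsto (fun m => (∑ i, c i * g (ns m) (x i)) ^ 2) atTop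
      (𝓝 ((c ⬝ᵥ fun i => f (x i)) ^ 2)) :=
    (tendsto_finsetSum _ fun i _ => (hx i).const_mul (c i)).pow 2
  exact le_of_tendsto' hlim fun m => hpart (ns m)

end Mercer

/-! ### Averaging over noise independent of the covariates. -/

section Noise

variable {X : Type*} [MeasurableSpace X] {n : ℕ} {Ω : Type*} [MeasurableSpace Ω] {μ : Measure Ω}
  [IsProbabilityMeasure μ] {ρ : Measure X} {σ : ℝ} {Z : Fin n → Ω → X} {ε : Fin n → Ω → ℝ}

/-- A bounded function of the covariates times an integrable function of the noise. -/
lemma IsSample.integral_mul (hs : IsSample μ ρ σ Z ε) {g : (Fin n → X) → ℝ} (hg : Measurable g)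
    {C : ℝ} (hC : ∀ᵐ ω ∂μ, |g fun i => Z i ω| ≤ C) {h : (Fin n → ℝ) → ℝ} (hh : Measurable h)
    (hi : Integrable (fun ω => h fun i => ε i ω) μ) :
    Integrable (fun ω => (g fun i => Z i ω) * h fun i => ε i ω) μ ∧
      ∫ ω, (g fun i => Z i ω) * (h fun i => ε i ω) ∂μ
        = (∫ ω, g fun i => Z i ω ∂μ) * ∫ ω, h fun i => ε i ω ∂μ := by
  have hgm : Measurable fun ω => g fun i => Z i ω :=
    hg.comp (measurable_pi_lambda _ hs.measurable_covariate)
  have hind : IndepFun (fun ω => g fun i => Z i ω) (fun ω => h fun i => ε i ω) μ :=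
    hs.indep_covariate_noise.comp hg hh
  have hgi : Integrable (fun ω => g fun i => Z i ω) μ :=
    Integrable.of_bound hgm.aestronglyMeasurable C hC
  exact ⟨hind.integrable_mul hgi hi, hind.integral_fun_mul_eq_mul_integral hgi.1 hi.1⟩

omit [IsProbabilityMeasure μ] in
lemma IsSample.integrable_noise_mul (hs : IsSample μ ρ σ Z ε) (j k : Fin n) :
    Integrable (fun ω => ε j ω * ε k ω) μ :=
  (hs.memLp_noise j).integrable_mul (hs.memLp_noise k)

omit [IsProbabilityMeasure μ] in
lemma IsSample.integral_noise_mul (hs : IsSample μ ρ σ Z ε) (j k : Fin n) :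
    ∫ ω, ε j ω * ε k ω ∂μ = if j = k then σ ^ 2 else 0 := by
  split_ifs with h
  · subst h
    simp only [← sq, hs.variance_noise]
  · rw [(hs.indep_noise.indepFun h).integral_fun_mul_eq_mul_integral (hs.memLp_noise j).1
      (hs.memLp_noise k).1, hs.centered_noise, zero_mul]

/-- Bias-variance decomposition of the square of a random affine function of the noise whose
coefficients depend on the covariates. -/
theorem IsSample.integral_sq_affine (hs : IsSample μ ρ σ Z ε) {β : (Fin n → X) → ℝ}
    (hβ : Measurable β) {C : ℝ} (hC : ∀ᵐ ω ∂μ, |β fun i => Z i ω| ≤ C)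
    {a : Fin n → (Fin n → X) → ℝ} (ha : ∀ j, Measurable (a j)) {D : ℝ} (hD : ∀ j x, |a j x| ≤ D) :
    Integrable (fun ω => ((β fun i => Z i ω) + ∑ j, (a j fun i => Z i ω) * ε j ω) ^ 2) μ ∧
      ∫ ω, ((β fun i => Z i ω) + ∑ j, (a j fun i => Z i ω) * ε j ω) ^ 2 ∂μ
        = (∫ ω, (β fun i => Z i ω) ^ 2 ∂μ)
          + σ ^ 2 * ∑ j, ∫ ω, (a j fun i => Z i ω) ^ 2 ∂μ := by
  -- The linear terms average to zero by centering and the off-diagonal quadratic terms by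
  -- independence.
  have hexp : ∀ ω, ((β fun i => Z i ω) + ∑ j, (a j fun i => Z i ω) * ε j ω) ^ 2
      = (β fun i => Z i ω) ^ 2 + ((∑ j, (2 * (β fun i => Z i ω) * a j fun i => Z i ω) * ε j ω)
        + ∑ j, ∑ k, ((a j fun i => Z i ω) * a k fun i => Z i ω) * (ε j ω * ε k ω)) := by
    intro ω
    have h1 : ∑ j, ∑ k, ((a j fun i => Z i ω) * a k fun i => Z i ω) * (ε j ω * ε k ω)
        = (∑ j, (a j fun i => Z i ω) * ε j ω) * ∑ k, (a k fun i => Z i ω) * ε k ω := by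
      rw [Finset.sum_mul_sum]
      exact Finset.sum_congr rfl fun j _ => Finset.sum_congr rfl fun k _ => by ring
    have h2 : ∑ j, (2 * (β fun i => Z i ω) * a j fun i => Z i ω) * ε j ω
        = 2 * (β fun i => Z i ω) * ∑ j, (a j fun i => Z i ω) * ε j ω := by
      rw [Finset.mul_sum]
      exact Finset.sum_congr rfl fun j _ => by ring
    rw [h1, h2]
    ring
  have hlin : ∀ j, Integrable (fun ω => (2 * (β fun i => Z i ω) * a j fun i => Z i ω) * ε j ω) μ ∧
      ∫ ω, (2 * (β fun i => Z i ω) * a j fun i => Z i ω) * ε j ω ∂μ = 0 := by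
    intro j
    have h := hs.integral_mul (g := fun x => 2 * β x * a j x) (C := 2 * C * D)
      (by have := ha j; fun_prop) (by
        filter_upwards [hC] with ω hω
        rw [abs_mul, abs_mul, abs_two]
        exact mul_le_mul (mul_le_mul_of_nonneg_left hω zero_le_two) (hD j _) (abs_nonneg _)
          (mul_nonneg zero_le_two ((abs_nonneg _).trans hω)))
      (h := fun e => e j) (measurable_pi_apply j) ((hs.memLp_noise j).integrable (by norm_num))
    rw [hs.centered_noise, mul_zero] at h
    exact h
  have hquad : ∀ j k, Integrable
      (fun ω => ((a j fun i => Z i ω) * a k fun i => Z i ω) * (ε j ω * ε k ω)) μ ∧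
      ∫ ω, ((a j fun i => Z i ω) * a k fun i => Z i ω) * (ε j ω * ε k ω) ∂μ
        = if j = k then σ ^ 2 * ∫ ω, (a j fun i => Z i ω) ^ 2 ∂μ else 0 := by
    intro j k
    have h := hs.integral_mul (g := fun x => a j x * a k x) (C := D * D)
      ((ha j).mul (ha k)) (by
        refine Eventually.of_forall fun ω => ?_
        rw [abs_mul]
        exact mul_le_mul (hD j _) (hD k _) (abs_nonneg _)
          ((abs_nonneg _).trans (hD j fun i => Z i ω)))
      (h := fun e => e j * e k) (by fun_prop) (hs.integrable_noise_mul j k)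
    rw [hs.integral_noise_mul] at h
    refine ⟨h.1, h.2.trans ?_⟩
    split_ifs with hjk
    · subst hjk
      simp only [sq, mul_comm]
    · simp
  have hβ2 : Integrable (fun ω => (β fun i => Z i ω) ^ 2) μ := by
    have hm : Measurable fun ω => β fun i => Z i ω :=
      hβ.comp (measurable_pi_lambda _ hs.measurable_covariate)
    refine Integrable.of_bound (hm.pow_const 2).aestronglyMeasurable (C ^ 2) ?_
    filter_upwards [hC] with ω hω
    rw [Real.norm_eq_abs, abs_pow]
    exact pow_le_pow_left₀ (abs_nonneg _) hω 2
  have hL : Integrable (fun ω => ∑ j, (2 * (β fun i => Z i ω) * a j fun i => Z i ω) * ε j ω) μ :=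
    integrable_finsetSum _ fun j _ => (hlin j).1
  have hQ : Integrable (fun ω =>
      ∑ j, ∑ k, ((a j fun i => Z i ω) * a k fun i => Z i ω) * (ε j ω * ε k ω)) μ :=
    integrable_finsetSum _ fun j _ => integrable_finsetSum _ fun k _ => (hquad j k).1
  simp only [hexp]
  refine ⟨hβ2.add (hL.add hQ), ?_⟩
  refine (integral_add hβ2 (hL.add hQ)).trans
    (congrArg₂ (· + ·) rfl ((integral_add hL hQ).trans ?_))
  rw [integral_finsetSum _ fun j _ => (hlin j).1,
    integral_finsetSum _ fun j _ => integrable_finsetSum _ fun k _ => (hquad j k).1]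
  simp only [(hlin _).2, integral_finsetSum _ fun k _ => (hquad _ k).1, (hquad _ _).2]
  simp [Finset.mul_sum]

end Noise

/-! ### The risk bound for a general truncation level. -/

section Risk

open Matrix

variable {X : Type*} {n : ℕ} {K : X → X → ℝ}

/-- The ridge smoother `[K(x_i, x_j)] ([K(x_i, x_j)] + n λ I)⁻¹`. -/
def hatMatrix (K : X → X → ℝ) (lam : ℝ) (x : Fin n → X) : Matrix (Fin n) (Fin n) ℝ :=
  kernelMatrix K x * (kernelMatrix K x + ((n : ℝ) * lam) • (1 : Matrix (Fin n) (Fin n) ℝ))⁻¹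

lemma posSemidef_kernelMatrix (hK : (Matrix.of K).PosSemidef) (x : Fin n → X) :
    (kernelMatrix K x).PosSemidef :=
  hK.submatrix x

lemma krrEstimator_apply_sample (hK : (Matrix.of K).PosSemidef) (lam : ℝ) (x : Fin n → X)
    (y : Fin n → ℝ) (i : Fin n) :
    krrEstimator K lam x y (x i) = (hatMatrix K lam x *ᵥ y) i := by
  have hsymm : ∀ u v, K u v = K v u := fun u v => by simpa using (hK.1.apply u v).symm
  rw [hatMatrix, ← Matrix.mulVec_mulVec, krrEstimator]
  simp only [mulVec, dotProduct, kernelMatrix, krrCoeff, Matrix.of_apply]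
  exact Finset.sum_congr rfl fun j _ => by rw [hsymm (x j) (x i), mul_comm]

/-- The inverse is the adjugate over a determinant that never vanishes. Continuity makes the
smoother's entries measurable and, on a compact space, bounded. -/
lemma continuous_hatMatrix [TopologicalSpace X] (hK : IsMercerKernel K) {lam : ℝ} (hn : 1 ≤ n)
    (hlam : 0 < lam) : Continuous fun x : Fin n → X => hatMatrix K lam x := by
  have ht : 0 < (n : ℝ) * lam := mul_pos (by exact_mod_cast hn) hlam
  have h1 : Continuous fun x : Fin n → X => kernelMatrix K x :=
    continuous_matrix fun i j => by
      have h : Continuous fun x : Fin n → X => K (x i) (x j) :=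
        Continuous.comp (f := fun x : Fin n → X => (x i, x j)) hK.continuous (by fun_prop)
      exact h
  have h2 : Continuous fun x : Fin n → X =>
      kernelMatrix K x + ((n : ℝ) * lam) • (1 : Matrix (Fin n) (Fin n) ℝ) :=
    h1.add continuous_const
  refine h1.matrix_mul ?_
  simp only [Matrix.inv_def, Ring.inverse_eq_inv']
  exact (h2.matrix_det.inv₀ fun x =>
    (isUnit_det_add_smul_one (posSemidef_kernelMatrix hK.posSemidef x) ht).ne_zero).smul
    h2.matrix_adjugate

lemma HasDensityBoundedBy.le_smul [MeasurableSpace X] {ρ P : Measure X} [IsProbabilityMeasure ρ]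
    [IsProbabilityMeasure P] {M : ℝ} (h : HasDensityBoundedBy ρ P M) :
    ρ ≤ ENNReal.ofReal M • P := by
  rw [← Measure.withDensity_rnDeriv_eq ρ P h.absolutelyContinuous, ← withDensity_const]
  exact withDensity_mono h.bounded

/-- Risk bound for kernel ridge regression: squared bias at most `λ R²`, and variance controlled
by the number `N` of leading eigenvalues and the trace of the remaining part of the operator. -/
theorem risk_le [TopologicalSpace X] [CompactSpace X] [SecondCountableTopology X]
    [MeasurableSpace X] [BorelSpace X] {P ρ : Measure X} [IsProbabilityMeasure P]
    [IsProbabilityMeasure ρ] {M : ℝ} (hM : 0 ≤ M) {ev : ℕ → ℝ} {φ : ℕ → X → ℝ}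
    (hK : IsMercerKernel K) (hinj : IsInjectiveOnL2 K P) (hρ : HasDensityBoundedBy ρ P M)
    (hS : IsEigenSystem K P ev φ) {fstar : X → ℝ} {R : ℝ} (hf : MemRKHS P ev φ fstar)
    (hR : rkhsNorm P ev φ fstar ≤ R) (hn : 1 ≤ n) {σ : ℝ} {Ω : Type*} [MeasurableSpace Ω]
    {μ : Measure Ω} [IsProbabilityMeasure μ] {Z : Fin n → Ω → X} {ε : Fin n → Ω → ℝ}
    (hs : IsSample μ ρ σ Z ε) {lam : ℝ} (hlam : 0 < lam) (N : ℕ) :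
    Integrable (empiricalError K lam fstar Z ε) μ ∧
      ∫ ω, empiricalError K lam fstar Z ε ω ∂μ ≤ lam * R ^ 2
        + σ ^ 2 / n * (N + M * (∫ x, K x x ∂P - ∑ k ∈ Finset.range N, ev k) / lam) := by
  have hn0 : (0 : ℝ) < n := by exact_mod_cast hn
  have ht : 0 < (n : ℝ) * lam := mul_pos hn0 hlam
  have hpos : ∀ k, 0 < ev k := hS.ev_pos hK hinj
  have hZm : Measurable fun ω i => Z i ω := measurable_pi_lambda _ hs.measurable_covariate
  have hpsd := fun x : Fin n → X => posSemidef_kernelMatrix (n := n) hK.posSemidef x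
  -- the smoother
  have hHc : ∀ i j, Continuous fun x : Fin n → X => hatMatrix K lam x i j := fun i j =>
    (continuous_hatMatrix hK hn hlam).matrix_elem i j
  have hHb : ∃ D, ∀ i j, ∀ x : Fin n → X, |hatMatrix K lam x i j| ≤ D := by
    have h1 : ∀ q : Fin n × Fin n, ∃ D, ∀ x : Fin n → X, |hatMatrix K lam x q.1 q.2| ≤ D :=
      fun q => exists_norm_le_of_continuous (hHc q.1 q.2)
    choose D hD using h1
    refine ⟨∑ q, |D q|, fun i j x => (hD (i, j) x).trans ((le_abs_self _).trans ?_)⟩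
    exact Finset.single_le_sum (f := fun q => |D q|) (fun _ _ => abs_nonneg _)
      (Finset.mem_univ (i, j))
  obtain ⟨D, hD⟩ := hHb
  -- the bias
  obtain ⟨S, hSP, hSf⟩ := hf.exists_ellipsoid hK hS hinj hR
  -- `fstar` is only almost everywhere measurable; since `ρ ≪ P`, a measurable version agrees with
  -- it on the sample almost surely.
  obtain ⟨f₀, hf₀m, hf₀⟩ : ∃ f₀ : X → ℝ, Measurable f₀ ∧ fstar =ᵐ[P] f₀ :=
    ⟨hf.memLp.1.aemeasurable.mk _, hf.memLp.1.aemeasurable.measurable_mk,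
      hf.memLp.1.aemeasurable.ae_eq_mk⟩
  have hgood : ∀ᵐ ω ∂μ, ∀ i, Z i ω ∈ S ∧ fstar (Z i ω) = f₀ (Z i ω) := by
    rw [ae_all_iff]
    intro i
    have h1 : ∀ᵐ x ∂(μ.map (Z i)), x ∈ S ∧ fstar x = f₀ x := by
      rw [hs.law_covariate i]
      exact hρ.absolutelyContinuous.ae_le (hf₀.and hSP |>.mono fun x hx => ⟨hx.2, hx.1⟩)
    exact ae_of_ae_map (hs.measurable_covariate i).aemeasurable h1
  set β : Fin n → (Fin n → X) → ℝ := fun i x =>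
    (hatMatrix K lam x *ᵥ fun j => f₀ (x j)) i - f₀ (x i) with hβ
  have hβm : ∀ i, Measurable (β i) := by
    intro i
    simp only [hβ, mulVec, dotProduct]
    refine Measurable.sub (Finset.measurable_sum _ fun j _ => ?_)
      (hf₀m.comp (measurable_pi_apply i))
    exact (hHc i j).measurable.mul (hf₀m.comp (measurable_pi_apply j))
  have hβs : ∀ᵐ ω ∂μ, ∑ i, β i (fun j => Z j ω) ^ 2 ≤ n * lam * R ^ 2 := by
    filter_upwards [hgood] with ω hω
    refine sum_sq_ridge_sub_le (hpsd fun j => Z j ω) ht fun c => ?_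
    have h := hSf n (fun j => Z j ω) (fun i => (hω i).1) c
    simpa only [(hω _).2] using h
  have hβb : ∀ i, ∀ᵐ ω ∂μ, |β i fun j => Z j ω| ≤ √(n * lam * R ^ 2) := by
    intro i
    filter_upwards [hβs] with ω hω
    refine Real.abs_le_sqrt (le_trans ?_ hω)
    exact Finset.single_le_sum (f := fun i => β i (fun j => Z j ω) ^ 2) (fun _ _ => sq_nonneg _)
      (Finset.mem_univ i)
  have herr : empiricalError K lam fstar Z ε =ᵐ[μ] fun ω => (1 / (n : ℝ)) * ∑ i,
      (β i (fun j => Z j ω) + ∑ k, hatMatrix K lam (fun j => Z j ω) i k * ε k ω) ^ 2 := by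
    filter_upwards [hgood] with ω hω
    simp only [empiricalError]
    congr 1
    refine Finset.sum_congr rfl fun i _ => ?_
    rw [krrEstimator_apply_sample hK.posSemidef lam (fun j => Z j ω) _ i]
    simp only [(hω _).2, hβ, mulVec, dotProduct, mul_add, Finset.sum_add_distrib]
    ring
  have hrow := fun i => hs.integral_sq_affine (hβm i) (hβb i)
    (a := fun k x => hatMatrix K lam x i k) (fun k => (hHc i k).measurable) (hD i)
  have hint : Integrable (fun ω => (1 / (n : ℝ)) * ∑ i,
      (β i (fun j => Z j ω) + ∑ k, hatMatrix K lam (fun j => Z j ω) i k * ε k ω) ^ 2) μ :=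
    (integrable_finsetSum _ fun i _ => (hrow i).1).const_mul _
  refine ⟨hint.congr herr.symm, ?_⟩
  rw [integral_congr_ae herr, integral_const_mul, integral_finsetSum _ fun i _ => (hrow i).1]
  simp only [(hrow _).2]
  rw [Finset.sum_add_distrib, ← Finset.mul_sum]
  have hβi : ∀ i, Integrable (fun ω => β i (fun j => Z j ω) ^ 2) μ := by
    intro i
    refine Integrable.of_bound (((hβm i).comp hZm).pow_const 2).aestronglyMeasurable
      (n * lam * R ^ 2) ?_
    filter_upwards [hβs] with ω hω
    rw [Real.norm_of_nonneg (sq_nonneg _)]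
    exact (Finset.single_le_sum (f := fun i => β i (fun j => Z j ω) ^ 2) (fun _ _ => sq_nonneg _)
      (Finset.mem_univ i)).trans hω
  have hbias : ∑ i, ∫ ω, β i (fun j => Z j ω) ^ 2 ∂μ ≤ n * lam * R ^ 2 := by
    rw [← integral_finsetSum _ fun i _ => hβi i]
    refine (integral_mono_ae (integrable_finsetSum _ fun i _ => hβi i)
      (integrable_const (n * lam * R ^ 2)) hβs).trans_eq ?_
    simp
  -- the variance
  set r : X → ℝ := fun x => K x x - ∑ k ∈ Finset.range N, ev k * φ k x ^ 2 with hr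
  have hr0 : ∀ x, 0 ≤ r x := by
    intro x
    -- A one-point sample yields nonnegativity of the residual diagonal at every point.
    have h := (hS.posSemidef_sub hK hinj (fun _ : Fin 1 => x) N).diag_nonneg (i := 0)
    simp only [Matrix.sub_apply, Matrix.sum_apply, vecMulVec_apply, kernelMatrix,
      Matrix.of_apply] at h
    refine h.trans_eq ?_
    simp only [hr]
    congr 1
    refine Finset.sum_congr rfl fun k _ => ?_
    have := Real.mul_self_sqrt (hpos k).le
    linear_combination (φ k x) ^ 2 * this
  have hrP : Integrable r P :=
    hK.integrable_diag.sub (integrable_finsetSum _ fun k _ => hS.integrable_eigen_sq k)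
  have hrint : ∫ x, r x ∂P = ∫ x, K x x ∂P - ∑ k ∈ Finset.range N, ev k := by
    simp only [hr]
    rw [integral_sub hK.integrable_diag
      (integrable_finsetSum _ fun k _ => hS.integrable_eigen_sq k),
      integral_finsetSum _ fun k _ => hS.integrable_eigen_sq k]
    simp only [hS.integral_eigen_sq]
  have hrM : Integrable r (ENNReal.ofReal M • P) := hrP.smul_measure ENNReal.ofReal_ne_top
  have hrρ : Integrable r ρ := hrM.mono_measure hρ.le_smul
  have hrle : ∫ x, r x ∂ρ ≤ M * ∫ x, r x ∂P := by
    refine (integral_mono_measure hρ.le_smul (Eventually.of_forall hr0) hrM).trans_eq ?_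
    rw [integral_smul_measure, ENNReal.toReal_ofReal hM, smul_eq_mul]
  have hrZ : ∀ i, Integrable (fun ω => r (Z i ω)) μ ∧ ∫ ω, r (Z i ω) ∂μ = ∫ x, r x ∂ρ := by
    intro i
    have hZi := (hs.measurable_covariate i).aemeasurable (μ := μ)
    have hrm : Integrable r (μ.map (Z i)) := by rwa [hs.law_covariate i]
    refine ⟨hrm.comp_aemeasurable hZi, ?_⟩
    rw [← hs.law_covariate i, integral_map hZi hrm.1]
  have hHi : ∀ i k, Integrable (fun ω => hatMatrix K lam (fun j => Z j ω) i k ^ 2) μ := by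
    intro i k
    refine Integrable.of_bound
      (((hHc i k).measurable.comp hZm).pow_const 2).aestronglyMeasurable (D ^ 2)
      (Eventually.of_forall fun ω => ?_)
    rw [Real.norm_eq_abs, abs_pow]
    exact pow_le_pow_left₀ (abs_nonneg _) (hD i k _) 2
  have hvar : ∑ i, ∑ k, ∫ ω, hatMatrix K lam (fun j => Z j ω) i k ^ 2 ∂μ
      ≤ N + M * (∫ x, r x ∂P) / lam := by
    calc ∑ i, ∑ k, ∫ ω, hatMatrix K lam (fun j => Z j ω) i k ^ 2 ∂μ
        = ∫ ω, ∑ i, ∑ k, hatMatrix K lam (fun j => Z j ω) i k ^ 2 ∂μ := by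
          rw [integral_finsetSum _ fun i _ => integrable_finsetSum _ fun k _ => hHi i k]
          simp only [integral_finsetSum _ fun k _ => hHi _ k]
      _ ≤ ∫ ω, ((N : ℝ) + (∑ i, r (Z i ω)) / (n * lam)) ∂μ := by
          refine integral_mono
            (integrable_finsetSum _ fun i _ => integrable_finsetSum _ fun k _ => hHi i k)
            ((integrable_const _).add
              ((integrable_finsetSum _ fun i _ => (hrZ i).1).div_const _)) fun ω => ?_
          refine (sum_sq_ridge_le (hpsd fun j => Z j ω) ht N
            (fun k i => √(ev k) * φ k (Z i ω))
            (hS.posSemidef_sub hK hinj (fun j => Z j ω) N)).trans_eq ?_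
          simp only [hr, kernelMatrix, Matrix.of_apply, mul_pow, Real.sq_sqrt (hpos _).le]
      _ = N + (n * ∫ x, r x ∂ρ) / (n * lam) := by
          rw [integral_add (integrable_const _)
            ((integrable_finsetSum _ fun i _ => (hrZ i).1).div_const _), integral_div,
            integral_finsetSum _ fun i _ => (hrZ i).1]
          simp [(hrZ _).2]
      _ ≤ N + M * (∫ x, r x ∂P) / lam := by
          rw [mul_div_mul_left _ _ hn0.ne']
          gcongr
  rw [hrint] at hvar
  calc 1 / (n : ℝ) * (∑ i, ∫ ω, β i (fun j => Z j ω) ^ 2 ∂μ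
        + σ ^ 2 * ∑ i, ∑ k, ∫ ω, hatMatrix K lam (fun j => Z j ω) i k ^ 2 ∂μ)
      ≤ 1 / (n : ℝ) * (n * lam * R ^ 2 + σ ^ 2 *
        (N + M * (∫ x, K x x ∂P - ∑ k ∈ Finset.range N, ev k) / lam)) := by gcongr
    _ = _ := by field_simp

end Risk

/-! ### Eigenvalue tails and the choice of truncation. -/

section Rates

/-- The tail of a convergent series is controlled by uniform bounds on the partial sums of a
termwise majorant. -/
lemma sub_sum_range_le {u c : ℕ → ℝ} {T S : ℝ} {N : ℕ} (hu : HasSum u T)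
    (hc : ∀ k, N ≤ k → u k ≤ c k) (hS : ∀ m, ∑ k ∈ Finset.range m, c (k + N) ≤ S) :
    T - ∑ k ∈ Finset.range N, u k ≤ S := by
  refine le_of_tendsto' ((hasSum_nat_add_iff' N).2 hu).tendsto_sum_nat fun m => ?_
  exact (Finset.sum_le_sum fun k _ => hc (k + N) (Nat.le_add_left N k)).trans (hS m)

/-- A geometric series; the shift by one (zero-based indices) leaves a spare factor `exp (-b)`,
which is dropped. -/
lemma sum_exp_tail_le {b : ℝ} (hb : 0 < b) (N m : ℕ) :
    ∑ k ∈ Finset.range m, Real.exp (-b * (((k + N : ℕ) : ℝ) + 1))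
      ≤ Real.exp (-b * N) / (1 - Real.exp (-b)) := by
  have h1 : Real.exp (-b) < 1 := (Real.exp_lt_one_iff.2 (neg_lt_zero.2 hb))
  have h2 : ∀ k ∈ Finset.range m, Real.exp (-b * (((k + N : ℕ) : ℝ) + 1))
      ≤ Real.exp (-b * N) * Real.exp (-b) ^ k := by
    intro k _
    rw [← Real.exp_nat_mul, ← Real.exp_add, Real.exp_le_exp]
    push_cast
    nlinarith
  refine (Finset.sum_le_sum h2).trans ?_
  rw [← Finset.mul_sum, div_eq_mul_inv]
  refine mul_le_mul_of_nonneg_left ?_ (Real.exp_nonneg _)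
  rw [← tsum_geometric_of_lt_one (Real.exp_nonneg _) h1]
  exact (summable_geometric_of_lt_one (Real.exp_nonneg _) h1).sum_le_tsum _
    fun _ _ => pow_nonneg (Real.exp_nonneg _) _

/-- Comparison of a term of the series `∑ k⁻⁽¹⁺ᵖ⁾` with a telescoping difference. -/
lemma rpow_neg_le_sub {p u : ℝ} (hp : 0 < p) (hu : 0 < u) :
    (u + 1) ^ (-(p + 1)) ≤ (u ^ (-p) - (u + 1) ^ (-p)) / p := by
  have hu1 : 0 < u + 1 := by linarith
  -- A Bernoulli-type bound from `exp z ≥ 1 + z` and `log v ≥ 1 - 1/v`, valid for every `p > 0`.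
  have h1 : 1 + p * (1 / (u + 1)) ≤ ((u + 1) / u) ^ p := by
    have hlog : 1 - ((u + 1) / u)⁻¹ ≤ Real.log ((u + 1) / u) :=
      Real.one_sub_inv_le_log_of_pos (by positivity)
    have h2 : 1 - ((u + 1) / u)⁻¹ = 1 / (u + 1) := by field_simp; ring
    rw [h2] at hlog
    rw [Real.rpow_def_of_pos (by positivity)]
    have h3 := Real.add_one_le_exp (Real.log ((u + 1) / u) * p)
    nlinarith
  have h4 : u ^ (-p) = (u + 1) ^ (-p) * ((u + 1) / u) ^ p := by
    rw [Real.div_rpow hu1.le hu.le, Real.rpow_neg hu.le, Real.rpow_neg hu1.le]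
    have := (Real.rpow_pos_of_pos hu1 p).ne'
    field_simp
  have h5 : (u + 1) ^ (-(p + 1)) = (u + 1) ^ (-p) * (1 / (u + 1)) := by
    rw [neg_add, Real.rpow_add hu1, Real.rpow_neg_one, one_div]
  have h6 := Real.rpow_pos_of_pos hu1 (-p)
  rw [le_div_iff₀ hp, h4, h5]
  nlinarith [mul_le_mul_of_nonneg_left h1 h6.le]

lemma sum_rpow_tail_le {p : ℝ} (hp : 0 < p) {N : ℕ} (hN : 1 ≤ N) (m : ℕ) :
    ∑ k ∈ Finset.range m, (((k + N : ℕ) : ℝ) + 1) ^ (-(p + 1)) ≤ (N : ℝ) ^ (-p) / p := by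
  have hN0 : (0 : ℝ) < N := by exact_mod_cast hN
  have h1 : ∑ k ∈ Finset.range m, (((k + N : ℕ) : ℝ) + 1) ^ (-(p + 1))
      ≤ ((N : ℝ) ^ (-p) - ((m + N : ℕ) : ℝ) ^ (-p)) / p := by
    induction m with
    | zero => simp
    | succ m ih =>
      rw [Finset.sum_range_succ]
      have h2 := rpow_neg_le_sub hp (u := ((m + N : ℕ) : ℝ)) (by positivity)
      have h3 : ((m + 1 + N : ℕ) : ℝ) = ((m + N : ℕ) : ℝ) + 1 := by push_cast; ring
      rw [h3]
      refine (add_le_add ih h2).trans_eq ?_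
      ring
  refine h1.trans ?_
  gcongr
  exact sub_le_self _ (Real.rpow_nonneg (Nat.cast_nonneg _) _)

lemma natCeil_le_two_mul {y : ℝ} (hy : 1 ≤ y) : (⌈y⌉₊ : ℝ) ≤ 2 * y := by
  have := Nat.ceil_lt_add_one (zero_le_one.trans hy)
  linarith

/-- Balancing bias and variance at the truncation level `⌈y⌉`, when the rate is `y / x`. -/
lemma bias_add_variance_le {x y r lam τ₁ τ₂ T B M R : ℝ} (hx : 0 < x) (hy : 1 ≤ y)
    (hr : r = y / x) (hτ : 0 < τ₁) (h1 : τ₁ * r ≤ lam) (h2 : lam ≤ τ₂ * r) (hM : 0 ≤ M)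
    (hB : 0 ≤ B) (hT : T ≤ B * (y ^ 2 / x)) :
    lam * R ^ 2 + 1 / x * (⌈y⌉₊ + M * T / lam) ≤ (τ₂ * R ^ 2 + 2 + M * B / τ₁) * r := by
  have hy0 : 0 < y := by linarith
  have hr0 : 0 < r := hr ▸ div_pos hy0 hx
  have hlam : 0 < lam := (mul_pos hτ hr0).trans_le h1
  -- The lower bound `λ ≥ τ₁ y / x` converts a tail of order `y² / x` into a variance term of order
  -- `y`.
  have h3 : M * T / lam ≤ M * B / τ₁ * y := by
    calc M * T / lam ≤ M * (B * (y ^ 2 / x)) / lam := by gcongr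
      _ ≤ M * (B * (y ^ 2 / x)) / (τ₁ * r) := by gcongr
      _ = M * B / τ₁ * y := by rw [hr]; field_simp
  have h4 := natCeil_le_two_mul hy
  have h5 : lam * R ^ 2 ≤ τ₂ * r * R ^ 2 := mul_le_mul_of_nonneg_right h2 (sq_nonneg R)
  calc lam * R ^ 2 + 1 / x * (⌈y⌉₊ + M * T / lam)
      ≤ τ₂ * r * R ^ 2 + 1 / x * (2 * y + M * B / τ₁ * y) := by gcongr
    _ = _ := by rw [hr]; field_simp; ring

end Rates

end KRR
end

/-! ### The two decay regimes. -/

theorem proposition2 :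
    -- exponential decay of the eigenvalues
    (∀ (b A M R τ₁ τ₂ : ℝ), 0 < b → 0 < A → 0 < M → 0 < R → 0 < τ₁ → τ₁ ≤ τ₂ →
      ∃ C : ℝ, 0 < C ∧
        ∀ (d : ℕ) (X : Set (EuclideanSpace ℝ (Fin d))), IsCompact X →
        ∀ (K : X → X → ℝ), KRR.IsMercerKernel K →
        ∀ (P ρ : MeasureTheory.Measure X)
          [MeasureTheory.IsProbabilityMeasure P] [MeasureTheory.IsProbabilityMeasure ρ],
        KRR.IsInjectiveOnL2 K P → KRR.HasDensityBoundedBy ρ P M →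
        ∀ (ev : ℕ → ℝ) (φ : ℕ → X → ℝ), KRR.IsEigenSystem K P ev φ →
        ∀ (Nb : ℕ), 1 ≤ Nb → (∀ k : ℕ, Nb ≤ k + 1 → ev k ≤ A * Real.exp (-b * (k + 1))) →
        ∀ (fstar : X → ℝ), KRR.MemRKHS P ev φ fstar → KRR.rkhsNorm P ev φ fstar ≤ R →
        ∀ (n : ℕ) (σ : ℝ), 1 ≤ n → 0 < σ →
        ∀ (Ω : Type*) [MeasurableSpace Ω] (μ : MeasureTheory.Measure Ω)
          [MeasureTheory.IsProbabilityMeasure μ] (Z : Fin n → Ω → X) (ε : Fin n → Ω → ℝ),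
        KRR.IsSample μ ρ σ Z ε →
        ∀ (lam : ℝ), τ₁ * KRR.expRate b Nb n σ ≤ lam → lam ≤ τ₂ * KRR.expRate b Nb n σ →
          MeasureTheory.Integrable (KRR.empiricalError K lam fstar Z ε) μ ∧
          ∫ ω, KRR.empiricalError K lam fstar Z ε ω ∂μ ≤ C * KRR.expRate b Nb n σ)
    ∧
    -- polynomial decay of the eigenvalues
    (∀ (s a A D κ M R τ₁ τ₂ : ℝ), 0 ≤ a → a < s → 0 < A → 0 < D → 0 < κ → 0 < M → 0 < R →
        0 < τ₁ → τ₁ ≤ τ₂ →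
      ∃ C : ℝ, 0 < C ∧
        ∀ (d : ℕ) (X : Set (EuclideanSpace ℝ (Fin d))), IsCompact X →
        ∀ (K : X → X → ℝ), KRR.IsMercerKernel K → (∀ x, K x x ≤ κ) →
        ∀ (P ρ : MeasureTheory.Measure X)
          [MeasureTheory.IsProbabilityMeasure P] [MeasureTheory.IsProbabilityMeasure ρ],
        KRR.IsInjectiveOnL2 K P → KRR.HasDensityBoundedBy ρ P M →
        ∀ (ev : ℕ → ℝ) (φ : ℕ → X → ℝ), KRR.IsEigenSystem K P ev φ →
        (∀ (k : ℕ) (x : X), |φ k x| ≤ D * ((k : ℝ) + 1) ^ (a / 2)) →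
        ∀ (Ns : ℕ), 1 ≤ Ns → (∀ k : ℕ, Ns ≤ k + 1 → ev k ≤ A * ((k : ℝ) + 1) ^ (-(2 * s))) →
        ∀ (fstar : X → ℝ), KRR.MemRKHS P ev φ fstar → KRR.rkhsNorm P ev φ fstar ≤ R →
        ∀ (n : ℕ) (σ : ℝ), 1 ≤ n → 0 < σ →
        ∀ (Ω : Type*) [MeasurableSpace Ω] (μ : MeasureTheory.Measure Ω)
          [MeasureTheory.IsProbabilityMeasure μ] (Z : Fin n → Ω → X) (ε : Fin n → Ω → ℝ),
        KRR.IsSample μ ρ σ Z ε →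
        ∀ (lam : ℝ), τ₁ * KRR.polyRate s a Ns n σ ≤ lam → lam ≤ τ₂ * KRR.polyRate s a Ns n σ →
          MeasureTheory.Integrable (KRR.empiricalError K lam fstar Z ε) μ ∧
          ∫ ω, KRR.empiricalError K lam fstar Z ε ω ∂μ ≤ C * KRR.polyRate s a Ns n σ) := by
  constructor
  · intro b A M R τ₁ τ₂ hb hA hM hR hτ₁ hτ
    have hτ₂ : 0 < τ₂ := hτ₁.trans_le hτ
    have he : 0 < 1 - Real.exp (-b) := sub_pos.2 ((Real.exp_lt_one_iff.2 (neg_lt_zero.2 hb)))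
    -- The constant of `bias_add_variance_le`, with `B = A / (1 - exp (-b))` from the geometric
    -- tail.
    refine ⟨τ₂ * R ^ 2 + 2 + M * (A / (1 - Real.exp (-b))) / τ₁, by positivity, ?_⟩
    intro d X hX K hK P ρ _ _ hinj hρ ev φ hS Nb hNb hev fstar hf hfR n σ hn hσ Ω _ μ _ Z ε hs
      lam hl₁ hl₂
    have : CompactSpace X := isCompact_iff_compactSpace.1 hX
    have hn0 : (0 : ℝ) < n := by exact_mod_cast hn
    have hx : 0 < (n : ℝ) / σ ^ 2 := by positivity
    set x := (n : ℝ) / σ ^ 2 with hxdef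
    set y := max (Nb : ℝ) (Real.log x / b) with hydef
    have hNb1 : (1 : ℝ) ≤ Nb := by exact_mod_cast hNb
    have hy : 1 ≤ y := hNb1.trans (le_max_left _ _)
    have hr : KRR.expRate b Nb n σ = y / x := by
      have h1 : (1 : ℝ) / (b * n) * Real.log x = Real.log x / b / n := by field_simp
      rw [KRR.expRate, ← hxdef, h1, max_div_div_right hn0.le, ← hydef, hxdef]
      field_simp
    have hlam : 0 < lam := (mul_pos hτ₁ (hr ▸ div_pos (by linarith) hx)).trans_le hl₁
    obtain ⟨hint, hle⟩ := KRR.risk_le hM.le hK hinj hρ hS hf hfR hn hs hlam ⌈y⌉₊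
    refine ⟨hint, hle.trans ?_⟩
    rw [show σ ^ 2 / (n : ℝ) = 1 / x by rw [hxdef, one_div_div]]
    refine KRR.bias_add_variance_le hx hy hr hτ₁ hl₁ hl₂ hM.le (by positivity) ?_
    have hNy : y ≤ (⌈y⌉₊ : ℝ) := Nat.le_ceil y
    have hT := KRR.sub_sum_range_le (N := ⌈y⌉₊) (hS.hasSum_ev hK hinj)
      (c := fun k => A * Real.exp (-b * (k + 1)))
      (S := A * (Real.exp (-b * (⌈y⌉₊ : ℝ)) / (1 - Real.exp (-b))))
      (fun k hk => hev k (by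
        have : (Nb : ℝ) ≤ k := (le_max_left _ _).trans (hNy.trans (by exact_mod_cast hk))
        have : Nb ≤ k := by exact_mod_cast this
        omega))
      (fun m => by
        rw [← Finset.mul_sum]
        exact mul_le_mul_of_nonneg_left (KRR.sum_exp_tail_le hb _ m) hA.le)
    refine hT.trans ?_
    -- `⌈y⌉ ≥ log x / b` makes the exponential at most `1 / x`, and `y ≥ 1` absorbs the rest.
    have hexp : Real.exp (-b * (⌈y⌉₊ : ℝ)) ≤ y ^ 2 / x := by
      have h1 : Real.log x ≤ b * (⌈y⌉₊ : ℝ) := by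
        have : Real.log x / b ≤ (⌈y⌉₊ : ℝ) := (le_max_right _ _).trans hNy
        rwa [div_le_iff₀' hb] at this
      calc Real.exp (-b * (⌈y⌉₊ : ℝ)) ≤ Real.exp (-Real.log x) := by
            rw [Real.exp_le_exp]; linarith
        _ = 1 / x := by rw [Real.exp_neg, Real.exp_log hx, one_div]
        _ ≤ y ^ 2 / x := by gcongr; exact one_le_pow₀ hy
    rw [mul_div_assoc', mul_comm A, mul_div_assoc, mul_comm]
    exact mul_le_mul_of_nonneg_left hexp (by positivity)
  · intro s a A D κ M R τ₁ τ₂ ha has hA _ hκ hM hR hτ₁ hτ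
    have hτ₂ : 0 < τ₂ := hτ₁.trans_le hτ
    have hs0 : 0 < s := ha.trans_lt has
    -- `κ` serves when `2s ≤ 1`, where the quotient is nonpositive (zero by convention at `2s = 1`);
    -- the quotient bounds the tail series when `2s > 1`.
    set C₁ := max κ (A / (2 * s - 1)) with hC₁
    have hC₁0 : 0 < C₁ := hκ.trans_le (le_max_left _ _)
    refine ⟨τ₂ * R ^ 2 + 2 + M * (2 * C₁) / τ₁, by positivity, ?_⟩
    intro d X hX K hK hKκ P ρ _ _ hinj hρ ev φ hS _ Ns hNs hev fstar hf hfR n σ hn hσ Ω _ μ _ Z ε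
      hs lam hl₁ hl₂
    have : CompactSpace X := isCompact_iff_compactSpace.1 hX
    have hn0 : (0 : ℝ) < n := by exact_mod_cast hn
    have hx : 0 < (n : ℝ) / σ ^ 2 := by positivity
    set x := (n : ℝ) / σ ^ 2 with hxdef
    set p := 2 * s + min 1 (2 - a) with hpdef
    have hp1 : 1 ≤ p ∧ p ≤ 2 * s + 1 := by
      refine ⟨?_, by have := min_le_left 1 (2 - a); linarith⟩
      rcases min_cases 1 (2 - a) with h | h <;> linarith
    have hp0 : 0 < p := by linarith [hp1.1]
    set y := max (Ns : ℝ) (x ^ (1 / p)) with hydef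
    have hNs1 : (1 : ℝ) ≤ Ns := by exact_mod_cast hNs
    have hy : 1 ≤ y := hNs1.trans (le_max_left _ _)
    have hy0 : 0 < y := by linarith
    have hr : KRR.polyRate s a Ns n σ = y / x := by
      have h1 : x ^ (-((p - 1) / p)) = x ^ (1 / p) / x := by
        rw [← Real.rpow_sub_one hx.ne']
        congr 1
        field_simp
        ring
      have h2 : σ ^ 2 * ((Ns : ℝ) / n) = Ns / x := by rw [hxdef]; field_simp
      rw [KRR.polyRate, ← hxdef, ← hpdef, h1, h2, max_div_div_right hx.le]
    have hlam : 0 < lam := (mul_pos hτ₁ (hr ▸ div_pos hy0 hx)).trans_le hl₁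
    obtain ⟨hint, hle⟩ := KRR.risk_le hM.le hK hinj hρ hS hf hfR hn hs hlam ⌈y⌉₊
    refine ⟨hint, hle.trans ?_⟩
    rw [show σ ^ 2 / (n : ℝ) = 1 / x by rw [hxdef, one_div_div]]
    refine KRR.bias_add_variance_le hx hy hr hτ₁ hl₁ hl₂ hM.le (by positivity) ?_
    have hNy : y ≤ (⌈y⌉₊ : ℝ) := Nat.le_ceil y
    have hN1 : (1 : ℝ) ≤ (⌈y⌉₊ : ℝ) := hy.trans hNy
    have hN1' : 1 ≤ ⌈y⌉₊ := by exact_mod_cast hN1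
    -- For `2s ≤ 1` the decay bound need not be summable, but the full trace is at most `κ` and the
    -- power of `⌈y⌉` is at least 1.
    have hT : ∫ x, K x x ∂P - ∑ k ∈ Finset.range ⌈y⌉₊, ev k
        ≤ C₁ * (⌈y⌉₊ : ℝ) ^ (1 - 2 * s) := by
      rcases le_or_gt (2 * s) 1 with h | h
      · have h1 : ∫ x, K x x ∂P ≤ κ := by
          refine (MeasureTheory.integral_mono hK.integrable_diag
            (MeasureTheory.integrable_const κ) hKκ).trans_eq (by simp)
        have h2 : 0 ≤ ∑ k ∈ Finset.range ⌈y⌉₊, ev k :=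
          Finset.sum_nonneg fun k _ => (hS.ev_pos hK hinj k).le
        have h3 : 1 ≤ (⌈y⌉₊ : ℝ) ^ (1 - 2 * s) := Real.one_le_rpow hN1 (by linarith)
        calc ∫ x, K x x ∂P - ∑ k ∈ Finset.range ⌈y⌉₊, ev k ≤ C₁ * 1 := by
              have := le_max_left κ (A / (2 * s - 1)); linarith
          _ ≤ _ := mul_le_mul_of_nonneg_left h3 hC₁0.le
      · refine (KRR.sub_sum_range_le (N := ⌈y⌉₊) (hS.hasSum_ev hK hinj)
          (c := fun k => A * ((k : ℝ) + 1) ^ (-(2 * s)))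
          (S := A * ((⌈y⌉₊ : ℝ) ^ (-(2 * s - 1)) / (2 * s - 1)))
          (fun k hk => hev k (by
            have : (Ns : ℝ) ≤ k := (le_max_left _ _).trans (hNy.trans (by exact_mod_cast hk))
            have : Ns ≤ k := by exact_mod_cast this
            omega))
          (fun m => by
            rw [← Finset.mul_sum]
            have h1 := KRR.sum_rpow_tail_le (p := 2 * s - 1) (by linarith) hN1' m
            rw [sub_add_cancel] at h1
            exact mul_le_mul_of_nonneg_left h1 hA.le)).trans ?_
        rw [neg_sub, mul_div_assoc', mul_comm A, mul_div_assoc, mul_comm]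
        exact mul_le_mul_of_nonneg_right (le_max_right _ _) (by positivity)
    -- Source of the factor 2 in the constant: `⌈y⌉ ≤ 2y` with an exponent at most 1 if `2s ≤ 1`,
    -- monotonicity otherwise.
    have hpow : (⌈y⌉₊ : ℝ) ^ (1 - 2 * s) ≤ 2 * y ^ (1 - 2 * s) := by
      have hypos : 0 < y ^ (1 - 2 * s) := Real.rpow_pos_of_pos hy0 _
      rcases le_or_gt (2 * s) 1 with h | h
      · calc (⌈y⌉₊ : ℝ) ^ (1 - 2 * s) ≤ (2 * y) ^ (1 - 2 * s) :=
              Real.rpow_le_rpow (by positivity) (KRR.natCeil_le_two_mul hy) (by linarith)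
          _ = 2 ^ (1 - 2 * s) * y ^ (1 - 2 * s) := Real.mul_rpow (by norm_num) hy0.le
          _ ≤ 2 * y ^ (1 - 2 * s) := by
              refine mul_le_mul_of_nonneg_right ?_ hypos.le
              exact Real.rpow_le_self_of_one_le (by norm_num) (by linarith)
      · have := Real.rpow_le_rpow_of_nonpos hy0 hNy (z := 1 - 2 * s) (by linarith)
        linarith
    -- Only `γ ≤ 1` matters here: `y ≥ x^(1/p)` with `p = 2s + γ`, and `y ≥ 1` allows raising the
    -- exponent to `2s + 1`.
    have hxy : x ≤ y ^ (2 * s + 1) := by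
      calc x = (x ^ (1 / p)) ^ p := by
            rw [← Real.rpow_mul hx.le, one_div_mul_cancel hp0.ne', Real.rpow_one]
        _ ≤ y ^ p := Real.rpow_le_rpow (by positivity) (le_max_right _ _) hp0.le
        _ ≤ y ^ (2 * s + 1) := Real.rpow_le_rpow_of_exponent_le hy hp1.2
    have hyx : y ^ (1 - 2 * s) ≤ y ^ 2 / x := by
      rw [le_div_iff₀ hx]
      calc y ^ (1 - 2 * s) * x ≤ y ^ (1 - 2 * s) * y ^ (2 * s + 1) := by gcongr
        _ = y ^ 2 := by
            rw [← Real.rpow_add hy0, ← Real.rpow_natCast]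
            congr 1
            push_cast
            ring
    calc _ ≤ C₁ * (⌈y⌉₊ : ℝ) ^ (1 - 2 * s) := hT
      _ ≤ C₁ * (2 * (y ^ 2 / x)) := by gcongr; linarith
      _ = 2 * C₁ * (y ^ 2 / x) := by ring
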